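/- Let $k$ be a field, $G$ a discrete group with classifying space $BG=N(\star/\!/G)$ and universal bundle $EG\to BG$, and $X$ a simplicial set. By an $E_\infty$-algebra we mean a (unital) algebra over the Barratt–Eccles operad in unbounded differential graded $k$-vector spaces; these form a category $E_\infty\text{-}\mathsf{Alg}$, with quasi-isomorphisms as weak equivalences, degreewise surjections as fibrations, and with the tensoring $Y\otimes A$ over simplicial sets $Y$ that is left adjoint to the function object $B\mapsto B^{Y}=\operatorname{Hom}(N_*(Y),B)$. Let $A$ be a $G$-equivariant $E_\infty$-algebra, i.e. a functor $\star/\!/G\to E_\infty\text{-}\mathsf{Alg}$, and let $QA\to A$ be a $G$-equivariant map which is a cofibrant replacement of the underlying $E_\infty$-algebra. For a principal $G$-bundle $P$ over $X$ let $$\int_P A:=P\overset{\mathbb L}{\otimes}_G A=\int^{n}\bigl(P\times\Delta_n\times G^n\bigr)\otimes QA ,$$ the coend in $E_\infty\text{-}\mathsf{Alg}$ given by the realization of the simplicial bar construction $B_*(P,\star/\!/G,QA)$, and for a map $\varphi:X\to BG$ let $\int_\varphi A:=\int_{\varphi^*EG}A$ be the equivariant higher Hochschild chains of $\varphi$ with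 coefficients in $A$. Let $\mathsf{PBun}_G(X)$ be the groupoid of principal $G$-bundles over $X$ and $G$-equivariant maps over $X$. Then: 1. The $E_\infty$-algebra $\int_P A$ exists for every principal $G$-bundle $P$ over $X$. 2. For every choice of the coends $\int_P A$, there is a unique functor $$\int_{?}A:\mathsf{PBun}_G(X)\longrightarrow E_\infty\text{-}\mathsf{Alg}$$ that sends $P$ to $\int_P A$ and $f:P\to P'$ to the map induced by the maps $f\times\mathrm{id}\times\mathrm{id}:P\times\Delta_n\times G^n\to P'\times\Delta_n\times G^n$. 3. For all $\varphi_0,\varphi_1:X\to BG$, every isomorphism $\varphi_0^*EG\cong\varphi_1^*EG$ of principal $G$-bundles induces an isomorphism $\int_{\varphi_0}A\cong\int_{\varphi_1}A$ of $E_\infty$-algebras. 4. For every $\varphi:X\to BG$, the induced maps define an action of the group $\operatorname{Aut}(\varphi^*EG)$ of bundle automorphisms on $\int_\varphi A$ by automorphisms of $E_\infty$-algebras. -/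

import Mathlib

open CategoryTheory MonoidalCategory Opposite

universe u

namespace EqHH

/-! ## Signs and differential graded vector spaces -/

/-- The sign `(-1)^n`. -/
abbrev sgn (n : ℤ) : ℤˣ := n.negOnePow

section DG

variable {k : Type u} [Field k]

/-- The total space `⨁ i, Xᵢ` of a (homologically graded, unbounded) complex of vector spaces. -/
abbrev Tot (X : ChainComplex (ModuleCat.{u} k) ℤ) : Type u := DirectSum ℤ (fun i => X.X i)

/-- The elements of the total space that are homogeneous of degree `i`. -/
def homog (X : ChainComplex (ModuleCat.{u} k) ℤ) (i : ℤ) : Submodule k (Tot X) :=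
  LinearMap.range (DirectSum.lof k ℤ (fun i => X.X i) i)

/-- The differential, of degree `-1`, on the total space. -/
noncomputable def totD (X : ChainComplex (ModuleCat.{u} k) ℤ) : Tot X →ₗ[k] Tot X :=
  DirectSum.toModule k ℤ _
    (fun i => DirectSum.lof k ℤ (fun i => X.X i) (i - 1) ∘ₗ (X.d i (i - 1)).hom)

/-- The map induced by a chain map on total spaces. -/
noncomputable def totMap {X Y : ChainComplex (ModuleCat.{u} k) ℤ} (f : X ⟶ Y) :
    Tot X →ₗ[k] Tot Y :=
  DirectSum.lmap (fun i => (f.f i).hom)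

lemma totMap_id (X : ChainComplex (ModuleCat.{u} k) ℤ) : totMap (𝟙 X) = LinearMap.id :=
  DirectSum.lmap_id

lemma totMap_comp {X Y Z : ChainComplex (ModuleCat.{u} k) ℤ} (f : X ⟶ Y) (g : Y ⟶ Z) :
    totMap (f ≫ g) = totMap g ∘ₗ totMap f :=
  DirectSum.lmap_comp _ _

end DG

/-! ## The Barratt-Eccles operad

The Barratt-Eccles operad `E` is the `E_∞`-operad given in arity `r ≥ 0` by the normalized chains
`E(r) = N_*(EΣ_r; k)` on the simplicial set with `d`-simplices `Σ_r^{d+1}`.  A permutation is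
written as the word in which every letter of `Fin r` occurs exactly once, so that the generators
of `E(r)` in degree `d` are the families `w : Fin (d + 1) → Arr r`, and those with
`w_j = w_{j+1}` for some `j` are zero. -/

/-- A permutation of `Fin r`, written as a word. -/
def Arr (r : ℕ) : Type := {l : List (Fin r) // l.Nodup ∧ ∀ x, x ∈ l}

/-- The left action of the symmetric group by renaming the letters. -/
def Arr.relabel {r : ℕ} (σ : Equiv.Perm (Fin r)) (l : Arr r) : Arr r :=
  ⟨l.1.map σ, l.2.1.map σ.injective, fun x => by
    rw [List.mem_map]; exact ⟨σ.symm x, l.2.2 _, by simp⟩⟩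

/-- The word with one letter, which is the unit of the operad. -/
def Arr.one : Arr 1 := ⟨[0], by simp, fun x => by simp [Subsingleton.elim x 0]⟩

/-- The position, among `r + s` letters, of the letter `t ≠ i` after `s` letters have been put in
the place of `i`. -/
def outerIdx {r : ℕ} (i : Fin (r + 1)) (s : ℕ) (t : Fin (r + 1)) (h : t ≠ i) : Fin (r + s) :=
  if h' : t < i then ⟨t, by have := i.2; have : t.1 < i.1 := h'; omega⟩
  else ⟨t.1 - 1 + s, by
    have h1 := t.2
    have h2 : ¬ t.1 < i.1 := h'
    have h3 : t.1 ≠ i.1 := fun e => h (Fin.ext e)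
    omega⟩

/-- The position, among `r + s` letters, of the `u`-th of the letters put in the place of `i`. -/
def innerIdx {r : ℕ} (i : Fin (r + 1)) {s : ℕ} (u : Fin s) : Fin (r + s) :=
  ⟨i.1 + u.1, by have := i.2; have := u.2; omega⟩

lemma outerIdx_val {r : ℕ} (i : Fin (r + 1)) (s : ℕ) (t : Fin (r + 1)) (h : t ≠ i) :
    (outerIdx i s t h).1 = if t.1 < i.1 then t.1 else t.1 - 1 + s := by
  unfold outerIdx
  by_cases h' : t < i
  · rw [dif_pos h', if_pos (show t.1 < i.1 from h')]
  · rw [dif_neg h', if_neg (show ¬ t.1 < i.1 from h')]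

/-- The partial composition `l ∘_i m` of permutations: the word `m` is substituted for the letter
`i` of the word `l`. -/
def Arr.comp {r s : ℕ} (i : Fin (r + 1)) (l : Arr (r + 1)) (m : Arr s) : Arr (r + s) :=
  ⟨l.1.flatMap (fun t => if h : t = i then m.1.map (innerIdx i) else [outerIdx i s t h]), by
    rw [List.nodup_flatMap]
    constructor
    · intro t _
      split
      · refine m.2.1.map (fun a b hab => ?_)
        have := congrArg Fin.val hab
        simp only [innerIdx] at this
        exact Fin.ext (by omega)
      · simp
    · refine l.2.1.imp (fun {a b} hab => ?_)
      intro x hx hy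
      by_cases ha : a = i <;> by_cases hb : b = i
      · exact hab (ha.trans hb.symm)
      · simp only [ha, hb, dif_pos, dif_neg, not_false_eq_true, List.mem_map,
          List.mem_singleton] at hx hy
        obtain ⟨v, _, rfl⟩ := hx
        have h1 := congrArg Fin.val hy
        rw [outerIdx_val] at h1
        simp only [innerIdx] at h1
        have := v.2
        have h3 : b.1 ≠ i.1 := fun e => hb (Fin.ext e)
        split_ifs at h1 <;> omega
      · simp only [ha, hb, dif_pos, dif_neg, not_false_eq_true, List.mem_map,
          List.mem_singleton] at hx hy
        obtain ⟨v, _, rfl⟩ := hy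
        have h1 := congrArg Fin.val hx
        rw [outerIdx_val] at h1
        simp only [innerIdx] at h1
        have := v.2
        have h3 : a.1 ≠ i.1 := fun e => ha (Fin.ext e)
        split_ifs at h1 <;> omega
      · simp only [ha, hb, dif_neg, not_false_eq_true, List.mem_singleton] at hx hy
        have h1 := congrArg Fin.val (hx.symm.trans hy)
        rw [outerIdx_val, outerIdx_val] at h1
        have h2 : a.1 ≠ i.1 := fun e => ha (Fin.ext e)
        have h3 : b.1 ≠ i.1 := fun e => hb (Fin.ext e)
        have h4 : a.1 ≠ b.1 := fun e => hab (Fin.ext e)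
        split_ifs at h1 <;> omega, by
    intro x
    rw [List.mem_flatMap]
    by_cases h1 : x.1 < i.1
    · have hne : (⟨x.1, by omega⟩ : Fin (r + 1)) ≠ i := fun e => by
        have := congrArg Fin.val e; simp only at this; omega
      refine ⟨⟨x.1, by omega⟩, l.2.2 _, ?_⟩
      rw [dif_neg hne, List.mem_singleton]
      refine Fin.ext ?_
      rw [outerIdx_val, if_pos h1]
    · by_cases h2 : x.1 < i.1 + s
      · refine ⟨i, l.2.2 _, ?_⟩
        rw [dif_pos rfl, List.mem_map]
        refine ⟨⟨x.1 - i.1, by omega⟩, m.2.2 _, Fin.ext ?_⟩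
        simp only [innerIdx]; omega
      · have hx := x.2
        have hne : (⟨x.1 - s + 1, by omega⟩ : Fin (r + 1)) ≠ i := fun e => by
          have := congrArg Fin.val e; simp only at this; omega
        refine ⟨⟨x.1 - s + 1, by omega⟩, l.2.2 _, ?_⟩
        rw [dif_neg hne, List.mem_singleton]
        refine Fin.ext ?_
        rw [outerIdx_val, if_neg (by simp only; omega)]
        simp only; omega⟩

open Classical in
/-- The lattice paths from `(0, 0)` to `(p, q)`, i.e. the nondegenerate `(p + q)`-simplices of
`Δ^p × Δ^q`, which index the terms of the Eilenberg-Zilber shuffle map. -/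
noncomputable def paths (p q : ℕ) : Finset (Fin (p + q + 1) → Fin (p + 1) × Fin (q + 1)) :=
  Finset.univ.filter StrictMono

/-- The exponent of the sign of the shuffle belonging to a lattice path: the number of pairs
consisting of a step in the first direction and an earlier step in the second direction. -/
def pathExp {p q : ℕ} (γ : Fin (p + q + 1) → Fin (p + 1) × Fin (q + 1)) : ℤ :=
  ∑ j : Fin (p + q), (((γ j.succ).1.1 : ℤ) - (γ j.castSucc).1.1) * (γ j.castSucc).2.1

/-! ## `E_∞`-algebras -/

/-- An `E_∞`-algebra in differential graded `k`-vector spaces: an algebra over the Barratt-Eccles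
operad.  The operation belonging to a generator `w` is `act w`, and the operation belonging to a
linear combination of generators is the corresponding linear combination. -/
structure EInftyAlg (k : Type u) [Field k] where
  /-- the underlying differential graded vector space -/
  X : ChainComplex (ModuleCat.{u} k) ℤ
  /-- the operation belonging to a generator of degree `d` in arity `r` -/
  act : ∀ {r d : ℕ}, (Fin (d + 1) → Arr r) → MultilinearMap k (fun _ : Fin r => Tot X) (Tot X)
  /-- the operation has degree `d` -/
  act_mem : ∀ {r d : ℕ} (w : Fin (d + 1) → Arr r) (e : Fin r → ℤ) (x : Fin r → Tot X),
    (∀ t, x t ∈ homog X (e t)) → act w x ∈ homog X (d + ∑ t, e t)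
  /-- degenerate simplices are zero in the normalized chains -/
  act_degenerate : ∀ {r d : ℕ} (w : Fin (d + 1) → Arr r) (j : Fin d),
    w j.castSucc = w j.succ → act w = 0
  /-- compatibility with the differentials, in degree zero -/
  act_d_zero : ∀ {r : ℕ} (w : Fin (0 + 1) → Arr r) (e : Fin r → ℤ) (x : Fin r → Tot X),
    (∀ t, x t ∈ homog X (e t)) →
    totD X (act w x) =
      ∑ t, sgn (∑ s with s < t, e s) • act w (Function.update x t (totD X (x t)))
  /-- compatibility with the differentials, in positive degrees -/
  act_d_succ : ∀ {r d : ℕ} (w : Fin (d + 1 + 1) → Arr r) (e : Fin r → ℤ) (x : Fin r → Tot X),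
    (∀ t, x t ∈ homog X (e t)) →
    totD X (act w x) =
      (∑ l : Fin (d + 1 + 1), sgn l.1 • act (fun j => w (l.succAbove j)) x) +
      sgn ((d + 1 : ℕ) : ℤ) •
        ∑ t, sgn (∑ s with s < t, e s) • act w (Function.update x t (totD X (x t)))
  /-- equivariance, with the Koszul sign of the permutation of the arguments -/
  act_relabel : ∀ {r d : ℕ} (w : Fin (d + 1) → Arr r) (σ : Equiv.Perm (Fin r)) (e : Fin r → ℤ)
    (x : Fin r → Tot X), (∀ t, x t ∈ homog X (e t)) →
    act (fun j => (w j).relabel σ) x =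
      sgn (∑ a, ∑ b with a < b ∧ σ b < σ a, e (σ a) * e (σ b)) • act w (fun t => x (σ t))
  /-- the unit of the operad acts as the identity -/
  act_one : ∀ x : Fin 1 → Tot X, act (fun _ : Fin (0 + 1) => Arr.one) x = x 0
  /-- the composition `w ∘_i v` of the operad, defined by the shuffle map and the composition of
  permutations, acts as the composition of the operations -/
  act_comp : ∀ {r s p q : ℕ} (i : Fin (r + 1)) (w : Fin (p + 1) → Arr (r + 1))
    (v : Fin (q + 1) → Arr s) (e : Fin (r + s) → ℤ) (x : Fin (r + s) → Tot X),
    (∀ t, x t ∈ homog X (e t)) →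
    (∑ γ ∈ paths p q, sgn (pathExp γ) •
        act (d := p + q) (fun j => Arr.comp i (w (γ j).1) (v (γ j).2)) x) =
      sgn (q * ∑ t with t.1 < i.1, e t) •
        act w (fun t => if h : t = i then act v (fun a => x (innerIdx i a))
          else x (outerIdx i s t h))

namespace EInftyAlg

variable {k : Type u} [Field k]

/-- A morphism of `E_∞`-algebras: a chain map that commutes with all operations. -/
@[ext]
structure Hom (A B : EInftyAlg k) where
  hom : A.X ⟶ B.X
  map_act : ∀ {r d : ℕ} (w : Fin (d + 1) → Arr r) (x : Fin r → Tot A.X),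
    totMap hom (A.act w x) = B.act w (fun t => totMap hom (x t))

instance : Category (EInftyAlg k) where
  Hom := Hom
  id A := ⟨𝟙 _, fun w x => by simp [totMap_id]⟩
  comp f g := ⟨f.hom ≫ g.hom, fun w x => by
    simp only [totMap_comp, LinearMap.comp_apply, f.map_act, g.map_act]⟩

/-- The weak equivalences of `E_∞`-algebras are the quasi-isomorphisms. -/
def IsWeakEquiv {A B : EInftyAlg k} (f : A ⟶ B) : Prop := QuasiIso (Hom.hom f)

/-- The fibrations of `E_∞`-algebras, for the model structure induced from the projective model
structure on complexes, are the degreewise surjections. -/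
def IsFib {A B : EInftyAlg k} (f : A ⟶ B) : Prop :=
  ∀ i, Function.Surjective ((Hom.hom f).f i)

/-- An `E_∞`-algebra is cofibrant if the map from the initial algebra to it has the left lifting
property with respect to all trivial fibrations. -/
def IsCof (C : EInftyAlg k) : Prop :=
  ∀ ⦃A B : EInftyAlg k⦄ (p : A ⟶ B), IsFib p → IsWeakEquiv p →
    ∀ f : C ⟶ B, ∃ g : C ⟶ A, g ≫ p = f

end EInftyAlg

/-- A `G`-equivariant `E_∞`-algebra: a functor from the groupoid `⋆//G` with one object and
automorphism group `G` to `E_∞`-algebras. -/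
abbrev EquivEInftyAlg (G : Type u) [Group G] (k : Type u) [Field k] := SingleObj G ⥤ EInftyAlg k

/-- The `E_∞`-algebra underlying a `G`-equivariant one. -/
abbrev EquivEInftyAlg.under {G : Type u} [Group G] {k : Type u} [Field k]
    (A : EquivEInftyAlg G k) : EInftyAlg k := A.obj (SingleObj.star G)

/-- `q : Q ⟶ A` exhibits `Q`, with its `G`-action, as a cofibrant replacement of `A` as an
`E_∞`-algebra: the algebra underlying `Q` is cofibrant and `q` is a weak equivalence. -/
structure IsCofReplacement {G : Type u} [Group G] {k : Type u} [Field k]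
    {Q A : EquivEInftyAlg G k} (q : Q ⟶ A) : Prop where
  cof : Q.under.IsCof
  weq : EInftyAlg.IsWeakEquiv (q.app (SingleObj.star G))

/-! ## The action of the Barratt-Eccles operad on chains of simplicial sets

The Barratt-Eccles operad acts on normalized chains by natural maps
`E(r) ⊗ N_*(Y) → N_*(Y)^{⊗ r}`: the table reduction turns a simplex of permutations into a sum of
surjections, and a surjection acts by cutting a simplex into intervals. -/

/-- The table reduction, with the letters of `del` deleted from all rows. -/
def tableReductionAux {r : ℕ} (del : List (Fin r)) : List (List (Fin r)) → List (List (Fin r))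
  | [] => []
  | l :: ls =>
    let m := l.filter (fun a => a ∉ del)
    if ls = [] then [m]
    else (List.range m.length).flatMap (fun c =>
      (tableReductionAux (del ++ m.take c) ls).map (fun u => m.take (c + 1) ++ u))

/-- The table reduction, from simplices of permutations to sums of surjections, both written as
words.  From the first row an initial segment is read off, in all possible ways with at least one
letter; then its letters, except for the last one (the caesura), are deleted from all the
following rows, and one goes on with the next row.  From the last row everything is read off. -/
def tableReduction {r : ℕ} (ls : List (List (Fin r))) : List (List (Fin r)) :=
  tableReductionAux [] ls

open Classical in
/-- The ways to cut `{0 < … < n}` into `N` intervals `[c_j, c_{j+1}]` that overlap in their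
endpoints. -/
noncomputable def cuts (N n : ℕ) : Finset (Fin (N + 1) → Fin (n + 1)) :=
  Finset.univ.filter (fun c => Monotone c ∧ c 0 = 0 ∧ c (Fin.last N) = Fin.last n)

section Cuts

variable {r n : ℕ} (u : List (Fin r)) (c : Fin (u.length + 1) → Fin (n + 1))

/-- The `j`-th letter is not the last occurrence of that letter. -/
def IsInner (j : Fin u.length) : Prop := ∃ j', j < j' ∧ u.get j' = u.get j

open Classical in
/-- The length of the `j`-th interval: the number of its steps, plus one if it is inner. -/
noncomputable def cutLen (j : Fin u.length) : ℤ :=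
  (c j.succ).1 - (c j.castSucc).1 + if IsInner u j then 1 else 0

/-- The vertices of the `t`-th factor: the intervals labelled by `t`, one after the other. -/
def cutVerts (t : Fin r) : List (Fin (n + 1)) :=
  (List.finRange u.length).flatMap (fun j =>
    if u.get j = t then
      (List.finRange (n + 1)).filter (fun a => c j.castSucc ≤ a ∧ a ≤ c j.succ)
    else [])

/-- The dimension of the `t`-th factor. -/
def cutDim (t : Fin r) : ℤ := (cutVerts u c t).length - 1

open Classical in
/-- The exponent of the sign of a cut: the sum of the right endpoints of the inner intervals, plus
the exponent of the Koszul sign for sorting the intervals by their labels. -/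
noncomputable def cutExp : ℤ :=
  (∑ j with IsInner u j, ((c j.succ).1 : ℤ)) +
    ∑ a, ∑ b with a < b ∧ u.get b < u.get a, cutLen u c a * cutLen u c b

end Cuts

section

open Simplicial

/-- The face operator given by a strictly increasing nonempty list of vertices. -/
def faceHom {n : ℕ} (L : List (Fin (n + 1))) (h : L.SortedLT) (h0 : L ≠ []) :
    ⦋L.length - 1⦌ ⟶ ⦋n⦌ :=
  SimplexCategory.Hom.mk
    { toFun := fun j => L.get (j.cast (Nat.succ_pred_eq_of_pos (List.length_pos_iff.2 h0)))
      monotone' := fun _ _ hij => h.strictMono_get.monotone hij }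

/-! ## The tensoring over simplicial sets -/

open Classical in
/-- For a family of maps indexed by simplices, the map at the face of `y` with the vertices `L`;
zero if `L` has a repetition, i.e. if that face is degenerate. -/
noncomputable def atFace {Y : SSet.{u}} {M : Type*} [Zero M] (f : ∀ n : ℕ, Y _⦋n⦌ → M)
    {n : ℕ} (y : Y _⦋n⦌) (L : List (Fin (n + 1))) : M :=
  if h : L.SortedLT ∧ L ≠ [] then f _ (Y.map (faceHom L h.1 h.2).op y) else 0

section Tensor

variable {k : Type u} [Field k]

/-- A morphism of `E_∞`-algebras `A ⟶ B^Y`, or equivalently `Y ⊗ A ⟶ B`, for a simplicial set `Y`.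

Here `B^Y = Hom(N_*(Y), B)` is the function object of `E_∞`-algebras, i.e. the limit of the
`E_∞`-algebras `N^*(Δ^n) ⊗ B` over the simplices of `Y`; the Barratt-Eccles operad acts on it
through the Alexander-Whitney diagonal of `E(r)`, the action on the chains `N_*(Y)` and the action
on `B`.  The tensoring `Y ⊗ A` is the left adjoint of `B ↦ B^Y`.  In components, a morphism
`f : A ⟶ B^Y` is a family of linear maps `f_y : A → B` of degree `n`, for the `n`-simplices `y` of
`Y`, where `f_y a` is the value of the cochain `f a` at `y`. -/
@[ext]
structure TensorHom (Y : SSet.{u}) (A B : EInftyAlg k) where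
  toFun : ∀ n : ℕ, Y _⦋n⦌ → (Tot A.X →ₗ[k] Tot B.X)
  /-- `f_y` has degree `n` -/
  map_mem : ∀ (n : ℕ) (y : Y _⦋n⦌) (e : ℤ) (a : Tot A.X), a ∈ homog A.X e →
    toFun n y a ∈ homog B.X (e + n)
  /-- the cochains are normalized -/
  map_degenerate : ∀ (n : ℕ) (y : Y _⦋n⦌), y ∈ Y.degenerate n → toFun n y = 0
  /-- compatibility with the differentials, at vertices -/
  map_d_zero : ∀ (y : Y _⦋0⦌) (a : Tot A.X), toFun 0 y (totD A.X a) = totD B.X (toFun 0 y a)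
  /-- compatibility with the differentials, where the one of `B^Y` is
  `D F = d ∘ F - (-1)^{|F|} F ∘ ∂` -/
  map_d_succ : ∀ (n : ℕ) (y : Y _⦋n + 1⦌) (e : ℤ) (a : Tot A.X), a ∈ homog A.X e →
    toFun (n + 1) y (totD A.X a) = totD B.X (toFun (n + 1) y a) -
      sgn e • ∑ l : Fin (n + 2), sgn l.1 • toFun n (Y.δ l y) a
  /-- compatibility with the operations: on `B^Y`, a generator `w` of degree `d` acts on
  `F_1, …, F_r` by the sum over `p ≤ d` of
  `± (w_p, …, w_d)_B ∘ (F_1 ⊗ … ⊗ F_r) ∘ (w_0, …, w_p)_{N_*(Y)}` with the Koszul sign -/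
  map_act : ∀ {r d : ℕ} (w : Fin (d + 1) → Arr r) (n : ℕ) (y : Y _⦋n⦌) (e : Fin r → ℤ)
    (a : Fin r → Tot A.X), (∀ t, a t ∈ homog A.X (e t)) →
    toFun n y (A.act w a) =
      ∑ p : Fin (d + 1),
        ((tableReduction (List.ofFn (fun j : Fin (p.1 + 1) => (w ⟨j, by omega⟩).1))).map
          (fun u => ∑ c ∈ cuts u.length n,
            sgn (p * ((d : ℤ) - p + ∑ t, e t) + cutExp u c +
                ∑ t, ∑ s with s < t, e t * cutDim u c s) •
              B.act (d := d - p.1) (fun j => w ⟨p + j, by omega⟩)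
                (fun t => atFace toFun y (cutVerts u c t) (a t)))).sum

end Tensor

/-! ## Principal bundles -/

/-- A principal `G`-bundle over the simplicial set `X`, for a discrete group `G`: a simplicial set
over `X` with a fibrewise right `G`-action such that all fibres, in all simplicial degrees, are
nonempty with free and transitive action. -/
structure PBun (G : Type u) [Group G] (X : SSet.{u}) where
  /-- the total space -/
  P : SSet.{u}
  /-- the projection -/
  proj : P ⟶ X
  /-- the right action -/
  ract : ∀ {n : SimplexCategoryᵒᵖ}, P.obj n → G → P.obj n
  ract_one : ∀ {n} (x : P.obj n), ract x 1 = x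
  ract_mul : ∀ {n} (x : P.obj n) (g h : G), ract x (g * h) = ract (ract x g) h
  map_ract : ∀ {n m} (α : n ⟶ m) (x : P.obj n) (g : G), P.map α (ract x g) = ract (P.map α x) g
  proj_ract : ∀ {n} (x : P.obj n) (g : G), proj.app n (ract x g) = proj.app n x
  proj_surjective : ∀ n, Function.Surjective (proj.app n)
  torsor : ∀ {n} (x y : P.obj n), proj.app n x = proj.app n y → ∃! g, ract x g = y

namespace PBun

variable {G : Type u} [Group G] {X : SSet.{u}}

/-- A morphism of principal `G`-bundles over `X`: a `G`-equivariant map over `X`. -/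
@[ext]
structure Hom (P P' : PBun G X) where
  hom : P.P ⟶ P'.P
  w : hom ≫ P'.proj = P.proj
  map_ract : ∀ {n} (x : P.P.obj n) (g : G), hom.app n (P.ract x g) = P'.ract (hom.app n x) g

instance : Category (PBun G X) where
  Hom := Hom
  id P := ⟨𝟙 _, by simp, by simp⟩
  comp f g := ⟨f.hom ≫ g.hom, by simp [f.w, g.w], by simp [f.map_ract, g.map_ract]⟩

lemma Hom.proj_app {P P' : PBun G X} (f : Hom P P') {n} (x : P.P.obj n) :
    P'.proj.app n (f.hom.app n x) = P.proj.app n x := by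
  rw [← f.w]; rfl

lemma Hom.bijective {P P' : PBun G X} (f : Hom P P') (n) : Function.Bijective (f.hom.app n) := by
  constructor
  · intro x y hxy
    obtain ⟨g, rfl, -⟩ := P.torsor x y (by rw [← f.proj_app, hxy, f.proj_app])
    rw [f.map_ract] at hxy
    have h1 := (P'.torsor (f.hom.app n x) (f.hom.app n x) rfl).unique hxy.symm (P'.ract_one _)
    rw [h1, P.ract_one]
  · intro y
    obtain ⟨x, hx⟩ := P.proj_surjective n (P'.proj.app n y)
    obtain ⟨g, hg, -⟩ := P'.torsor (f.hom.app n x) y (by rw [f.proj_app, hx])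
    exact ⟨P.ract x g, by rw [f.map_ract, hg]⟩

instance : IsGroupoid (PBun G X) where
  all_isIso {P P'} f := by
    have h : ∀ n, IsIso ((Hom.hom f).app n) := fun n =>
      (CategoryTheory.isIso_iff_bijective _).2 (Hom.bijective f n)
    have h' : IsIso (Hom.hom f) := NatIso.isIso_of_isIso_app _
    have e1 : ∀ n (x : P'.P.obj n), (Hom.hom f).app n ((inv (Hom.hom f)).app n x) = x := by
      intro n x
      have := IsIso.inv_hom_id (Hom.hom f)
      exact congrArg (fun t : P'.P ⟶ P'.P => t.app n x) this
    refine ⟨⟨inv (Hom.hom f), ?_, ?_⟩, Hom.ext ?_, Hom.ext ?_⟩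
    · rw [IsIso.inv_comp_eq]; exact f.w.symm
    · intro n x g
      apply (Hom.bijective f n).1
      rw [f.map_ract, e1, e1]
    · exact IsIso.hom_inv_id (Hom.hom f)
    · exact IsIso.inv_hom_id (Hom.hom f)

end PBun

/-- The classifying space `BG`: the nerve of the groupoid `⋆//G`. -/
abbrev BG (G : Type u) [Group G] : SSet.{u} := nerve (SingleObj G)

/-- The element of `G` on the edge from vertex `i` to vertex `j` of an `n`-simplex of `BG`. -/
def edge {G : Type u} [Group G] {n : ℕ} (c : ComposableArrows (SingleObj G) n)
    (i j : Fin (n + 1)) (h : i ≤ j) : G :=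
  c.map (homOfLE h)

/-- The total space `EG` of the universal bundle, with `n`-simplices `G^{n+1}`, on which `G` acts
by simultaneous right multiplication. -/
def EG (G : Type u) [Group G] : SSet.{u} where
  obj n := Fin (n.unop.len + 1) → G
  map α := ↾fun e i => e (α.unop.toOrderHom i)

/-- The universal bundle `EG ⟶ BG`; the edge from `i` to `j` of the image of `(e_0, …, e_n)` is
labelled by `e_j e_i⁻¹`. -/
def EG.proj (G : Type u) [Group G] : EG G ⟶ BG G where
  app n := ↾fun e =>
    { obj := fun _ => SingleObj.star G
      map := fun {i j} _ => (e j * (e i)⁻¹ : G)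
      map_id := fun i => mul_inv_cancel (e i)
      map_comp := fun {i j l} _ _ =>
        (show e l * (e i)⁻¹ = (e l * (e j)⁻¹) * (e j * (e i)⁻¹) by group) }

lemma edge_EG_proj {G : Type u} [Group G] {n : SimplexCategoryᵒᵖ} (e : (EG G).obj n) (i j h) :
    edge ((EG.proj G).app n e) i j h = e j * (e i)⁻¹ := rfl

lemma edge_comp {G : Type u} [Group G] {n : ℕ} (c : ComposableArrows (SingleObj G) n)
    (i j l : Fin (n + 1)) (h : i ≤ j) (h' : j ≤ l) :
    edge c i l (h.trans h') = edge c j l h' * edge c i j h :=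
  c.map_comp (homOfLE h) (homOfLE h')

lemma BG_ext {G : Type u} [Group G] {n : ℕ} {c c' : ComposableArrows (SingleObj G) n}
    (h : ∀ i j hij, edge c i j hij = edge c' i j hij) : c = c' := by
  refine CategoryTheory.Functor.hext (fun _ => rfl) (fun i j f => heq_of_eq ?_)
  exact h i j (leOfHom f)

/-- The pullback `φ^*EG` of the universal bundle along `φ : X ⟶ BG`. -/
def bundleOf {G : Type u} [Group G] {X : SSet.{u}} (φ : X ⟶ BG G) : PBun G X where
  P :=
    { obj := fun n => {z : X.obj n × (EG G).obj n // φ.app n z.1 = (EG.proj G).app n z.2}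
      map := fun {n m} α => ↾fun z => ⟨(X.map α z.1.1, (EG G).map α z.1.2), by
        have h1 := congrArg (fun t => t z.1.1) (φ.naturality α)
        have h2 := congrArg (fun t => t z.1.2) ((EG.proj G).naturality α)
        have h3 := congrArg (fun t => (BG G).map α t) z.2
        exact h1.trans (h3.trans h2.symm)⟩
      map_id := fun n => ConcreteCategory.hom_ext _ _ fun z => by
        apply Subtype.ext
        exact Prod.ext (Functor.map_id_apply X n z.1.1) (Functor.map_id_apply (EG G) n z.1.2)
      map_comp := fun α β => ConcreteCategory.hom_ext _ _ fun z => by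
        apply Subtype.ext
        exact Prod.ext (Functor.map_comp_apply X α β z.1.1)
          (Functor.map_comp_apply (EG G) α β z.1.2) }
  proj := { app := fun n => ↾fun z => z.1.1 }
  ract := fun z g => ⟨(z.1.1, fun i => z.1.2 i * g), z.2.trans (BG_ext fun i j h => by
    rw [edge_EG_proj, edge_EG_proj]; group)⟩
  ract_one := fun z => Subtype.ext (Prod.ext rfl (funext fun i => mul_one _))
  ract_mul := fun z g h => Subtype.ext (Prod.ext rfl (funext fun i => (mul_assoc _ _ _).symm))
  map_ract := fun α z g => rfl
  proj_ract := fun z g => rfl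
  proj_surjective := fun n x => ⟨⟨(x, fun i => edge (φ.app n x) 0 i (Fin.zero_le i)),
    BG_ext fun i j h => by
      change edge (φ.app n x) i j h =
        edge (φ.app n x) 0 j (Fin.zero_le j) * (edge (φ.app n x) 0 i (Fin.zero_le i))⁻¹
      exact eq_mul_inv_of_mul_eq (edge_comp (φ.app n x) 0 i j (Fin.zero_le i) h).symm⟩, rfl⟩
  torsor := fun {n} z z' h => by
    obtain ⟨⟨x, e⟩, he⟩ := z
    obtain ⟨⟨x', e'⟩, he'⟩ := z'
    obtain rfl : x = x' := h
    refine ⟨(e 0)⁻¹ * e' 0, Subtype.ext (Prod.ext rfl (funext fun i => ?_)), fun g hg => ?_⟩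
    · have h1 : edge ((EG.proj G).app n e) 0 i (Fin.zero_le i)
          = edge ((EG.proj G).app n e') 0 i (Fin.zero_le i) := by
        rw [show (EG.proj G).app n e = (EG.proj G).app n e' from he.symm.trans he']
      rw [edge_EG_proj, edge_EG_proj] at h1
      change e i * ((e 0)⁻¹ * e' 0) = e' i
      rw [← mul_assoc, h1]; group
    · have h1 : e 0 * g = e' 0 := congrFun (congrArg (fun z => z.1.2) hg) 0
      rw [← h1]; group

/-! ## Equivariant higher Hochschild chains -/

section Chains

variable {k : Type u} [Field k] {G : Type u} [Group G] {X : SSet.{u}}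

/-- The automorphism of the underlying algebra by which `g` acts on a `G`-equivariant
`E_∞`-algebra. -/
abbrev EquivEInftyAlg.actBy (Q : EquivEInftyAlg G k) (g : G) : Q.under ⟶ Q.under :=
  Q.map (X := SingleObj.star G) (Y := SingleObj.star G) g

/-- A cowedge from `(P × Δ^m × G^n) ⊗ Q`, as a functor of `m` (through `Δ^m`) and, contravariantly,
of `n` (through the simplicial bar construction `B_n(P, ⋆//G, Q) = (P × G^n) ⊗ Q`), to `B`.

The set `G^n` is the set of `n`-simplices `c_0 → … → c_n` of `BG`; since it is discrete, a morphism
`(P × Δ^n × G^n) ⊗ Q ⟶ B` is a family of morphisms `(P × Δ^n) ⊗ Q ⟶ B` indexed by it.  As usual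
for the two-sided bar construction of a contravariant functor `P` and a covariant functor `Q`, the
summand of `c` is formed with the value of `P` at `c_n` and the value of `Q` at `c_0`, and
`α : [m] → [n]` acts by restricting `c` along `α`, by the right action on `P` of the arrow
`c_{α(m)} → c_n`, and by the action on `Q` of the arrow `c_0 → c_{α(0)}`. -/
structure Cowedge (P : PBun G X) (Q : EquivEInftyAlg G k) (B : EInftyAlg k) where
  toHom : ∀ n : ℕ, (BG G) _⦋n⦌ → TensorHom (P.P ⊗ Δ[n]) Q.under B
  w : ∀ {m n : ℕ} (α : ⦋m⦌ ⟶ ⦋n⦌) (c : (BG G) _⦋n⦌) (l : ℕ) (p : P.P _⦋l⦌)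
    (s : (Δ[m] : SSet.{u}) _⦋l⦌),
    (toHom n c).toFun l (p, (SSet.stdSimplex.map α).app _ s) =
      (toHom m ((BG G).map α.op c)).toFun l
          (P.ract p (edge c (α.toOrderHom (Fin.last m)) (Fin.last n) (Fin.le_last _)), s) ∘ₗ
        totMap (Q.actBy (edge c 0 (α.toOrderHom 0) (Fin.zero_le _))).hom

/-- The derived tensor product `P ⊗_G A`, computed with the cofibrant replacement `Q` of `A`: an
`E_∞`-algebra together with a universal cowedge, i.e. the coend `∫^n (P × Δ^n × G^n) ⊗ Q`. -/
structure Chains (P : PBun G X) (Q : EquivEInftyAlg G k) where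
  obj : EInftyAlg k
  cowedge : Cowedge P Q obj
  existsUnique_desc : ∀ (B : EInftyAlg k) (v : Cowedge P Q B), ∃! f : obj ⟶ B,
    ∀ (n : ℕ) (c : (BG G) _⦋n⦌) (l : ℕ) (y : (P.P ⊗ Δ[n]) _⦋l⦌),
      (v.toHom n c).toFun l y = totMap f.hom ∘ₗ (cowedge.toHom n c).toFun l y

/-- The `G`-equivariant higher Hochschild chains `∫_φ A = φ^*EG ⊗_G A` of `φ : X ⟶ BG`, computed
with the cofibrant replacement `Q` of `A`. -/
abbrev HochschildChains (φ : X ⟶ BG G) (Q : EquivEInftyAlg G k) := Chains (bundleOf φ) Q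

/-- `F` is the morphism `f ⊗_G A : P ⊗_G A ⟶ P' ⊗_G A`, i.e. the one that is induced on coends by
the maps `f × id × id` from `P × Δ^n × G^n` to `P' × Δ^n × G^n`. -/
def Chains.IsInduced {P P' : PBun G X} {Q : EquivEInftyAlg G k} (H : Chains P Q)
    (H' : Chains P' Q) (f : P ⟶ P') (F : H.obj ⟶ H'.obj) : Prop :=
  ∀ (n : ℕ) (c : (BG G) _⦋n⦌) (l : ℕ) (p : P.P _⦋l⦌) (s : (Δ[n] : SSet.{u}) _⦋l⦌),
    totMap F.hom ∘ₗ (H.cowedge.toHom n c).toFun l (p, s) =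
      (H'.cowedge.toHom n c).toFun l (f.hom.app _ p, s)

end Chains

end

end EqHH

/-!
The coend is constructed as the subalgebra generated by the values of all cowedges in the product
of their targets.  The cowedges form a large type, so that the product is too large to be an
algebra, but the subalgebra is not: in each degree it is the quotient of the vector space on all
expressions, formed from the generators with the differential and the operations, by the kernel of
the evaluation in the product.  Its algebra structure and the universal cowedge are well defined,
and their laws hold, because this is so after projection to every factor; a map out of it is
determined by its values on the generators.  Functoriality in the bundle, and with it the
isomorphisms and the action of the bundle automorphisms, follows from the uniqueness of maps out of
the coend.
-/

namespace EqHH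

lemma multilinearMap_apply_mem_of_span_eq_top {ι R N : Type*} [Finite ι] [CommRing R]
    [AddCommGroup N] [Module R N] {M : ι → Type*} [∀ i, AddCommGroup (M i)]
    [∀ i, Module R (M i)] {κ : ι → Type*} {g : ∀ i, κ i → M i}
    (hg : ∀ i, Submodule.span R (Set.range (g i)) = ⊤)
    (φ : MultilinearMap R M N) (S : Submodule R N)
    (h : ∀ j : (∀ i, κ i), φ (fun i => g i (j i)) ∈ S) (x : ∀ i, M i) : φ x ∈ S := by
  have : S.mkQ.compMultilinearMap φ = 0 :=
    MultilinearMap.ext_of_span_eq_top (g := @g) hg fun j => by simpa using h j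
  simpa using congrArg (· x) this

section Tot

variable {k : Type u} [Field k] {X Y : ChainComplex (ModuleCat.{u} k) ℤ}

/-- The inclusion of the degree `i` part of a complex into its total space. -/
noncomputable abbrev totOf (X : ChainComplex (ModuleCat.{u} k) ℤ) (i : ℤ) : X.X i →ₗ[k] Tot X :=
  DirectSum.lof k ℤ (fun i => X.X i) i

lemma totOf_mem_homog (i : ℤ) (x : X.X i) : totOf X i x ∈ homog X i :=
  ⟨x, rfl⟩

lemma totOf_apply_of_mem_homog {i : ℤ} {x : Tot X} (hx : x ∈ homog X i) : totOf X i (x i) = x := by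
  obtain ⟨y, rfl⟩ := hx
  rw [DirectSum.lof_apply]

lemma span_totOf_eq_top {ι : ℤ → Type*} {g : ∀ i, ι i → X.X i}
    (hg : ∀ i, Submodule.span k (Set.range (g i)) = ⊤) :
    Submodule.span k (Set.range fun m : Σ i, ι i => totOf X m.1 (g m.1 m.2)) = ⊤ := by
  rw [Set.range_sigma_eq_iUnion_range, Submodule.span_iUnion]
  refine .trans (iSup_congr fun i => ?_) DFinsupp.iSup_range_lsingle
  rw [Set.range_comp' (totOf X i) (g i), Submodule.span_image, hg, Submodule.map_top]
  rfl

lemma totD_totOf (i : ℤ) (x : X.X i) :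
    totD X (totOf X i x) = totOf X (i - 1) ((X.d i (i - 1)).hom x) := by
  simp [totD]

lemma totMap_apply (f : X ⟶ Y) (x : Tot X) (i : ℤ) : totMap f x i = (f.f i).hom (x i) :=
  rfl

lemma totMap_totOf (f : X ⟶ Y) (i : ℤ) (x : X.X i) :
    totMap f (totOf X i x) = totOf Y i ((f.f i).hom x) :=
  DirectSum.lmap_lof _ _ _

lemma totMap_totD (f : X ⟶ Y) (x : Tot X) : totMap f (totD X x) = totD Y (totMap f x) := by
  suffices totMap f ∘ₗ totD X = totD Y ∘ₗ totMap f from LinearMap.congr_fun this x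
  refine DirectSum.linearMap_ext _ fun i => LinearMap.ext fun y => ?_
  simp only [LinearMap.comp_apply, totD_totOf, totMap_totOf]
  exact congrArg (totOf Y (i - 1)) (ConcreteCategory.congr_hom (f.comm i (i - 1)) y).symm

lemma totMap_mem_homog (f : X ⟶ Y) {i : ℤ} {x : Tot X} (hx : x ∈ homog X i) :
    totMap f x ∈ homog Y i := by
  obtain ⟨y, rfl⟩ := hx
  exact ⟨(f.f i).hom y, (totMap_totOf f i y).symm⟩

lemma totMap_update (f : X ⟶ Y) {r : ℕ} (x : Fin r → Tot X) (t : Fin r) (y : Tot X) :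
    (fun s => totMap f (Function.update x t y s)) =
      Function.update (fun s => totMap f (x s)) t (totMap f y) :=
  funext fun s => Function.apply_update (fun _ => totMap f) x t y s

lemma totMap_injective : Function.Injective (totMap : (X ⟶ Y) → (Tot X →ₗ[k] Tot Y)) :=
  fun f g h => by
    ext i x
    refine DirectSum.of_injective (β := fun i => Y.X i) i ?_
    exact (totMap_totOf f i x).symm.trans ((LinearMap.congr_fun h _).trans (totMap_totOf g i x))

end Tot

/-! ## Subalgebras of large products -/

section Subproducts

variable {k : Type u} [Field k] {J : Type*}

/-- The differential of a product of complexes. The index type may be too large for the product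
to be a complex in `ModuleCat.{u} k`. -/
noncomputable def piD (C : J → ChainComplex (ModuleCat.{u} k) ℤ) (i j : ℤ) :
    (∀ p, (C p).X i) →ₗ[k] ∀ p, (C p).X j :=
  LinearMap.pi fun p => ((C p).d i j).hom ∘ₗ LinearMap.proj p

section

variable {C : J → ChainComplex (ModuleCat.{u} k) ℤ} {M : ℤ → Type u} [∀ i, AddCommGroup (M i)]
  [∀ i, Module k (M i)] (ι : ∀ i, M i →ₗ[k] ∀ p, (C p).X i) (hι : ∀ i, Function.Injective (ι i))
  (hd : ∀ i j x, piD C i j (ι i x) ∈ LinearMap.range (ι j))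

/-- The subcomplex of a product of complexes with given terms `M i`, embedded by `ι i`. -/
noncomputable def complexOfInjective : ChainComplex (ModuleCat.{u} k) ℤ where
  X i := ModuleCat.of k (M i)
  d i j := ModuleCat.ofHom <|
    LinearMap.codRestrictOfInjective (piD C i j ∘ₗ ι i) (ι j) (hι j) (hd i j)
  shape i j hij := by
    ext x
    apply hι j
    funext p
    simp [piD, (C p).shape i j hij]
  d_comp_d' i j l _ _ := by
    ext x
    apply hι l
    funext p
    simp [piD, ← ModuleCat.comp_apply]

/-- The projection of `complexOfInjective` to a factor of the product. -/
noncomputable def complexOfInjective.proj (p : J) : complexOfInjective ι hι hd ⟶ C p where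
  f i := ModuleCat.ofHom (LinearMap.proj p ∘ₗ ι i)
  comm' i j _ := by
    ext x
    exact (congrFun (LinearMap.codRestrictOfInjective_comp_apply (piD C i j ∘ₗ ι i) (ι j) (hι j)
      (hd i j) x) p).symm

end

variable {X : ChainComplex (ModuleCat.{u} k) ℤ}

/-- The map from a total space to a product of total spaces given by a family of chain maps. -/
noncomputable def totPi {C : J → ChainComplex (ModuleCat.{u} k) ℤ} (π : ∀ p, X ⟶ C p) :
    Tot X →ₗ[k] ∀ p, Tot (C p) :=
  LinearMap.pi fun p => totMap (π p)

section

variable {C : J → ChainComplex (ModuleCat.{u} k) ℤ} {π : ∀ p, X ⟶ C p}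

lemma totPi_injective
    (h : ∀ i, Function.Injective fun (x : X.X i) (p : J) => ((π p).f i).hom x) :
    Function.Injective (totPi π) :=
  fun _ _ hxy => DFinsupp.ext fun i => h i <| funext fun p =>
    congrArg (fun z : Tot (C p) => z i) (congrFun hxy p)

lemma ext_of_totPi_injective (hπ : Function.Injective (totPi π)) {x y : Tot X}
    (h : ∀ p, totMap (π p) x = totMap (π p) y) : x = y :=
  hπ (funext h)

lemma mem_homog_of_totPi_injective (hπ : Function.Injective (totPi π)) {i : ℤ} {x : Tot X}
    (h : ∀ p, totMap (π p) x ∈ homog (C p) i) : x ∈ homog X i := by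
  suffices totOf X i (x i) = x from this ▸ totOf_mem_homog i (x i)
  refine ext_of_totPi_injective hπ fun p => ?_
  rw [totMap_totOf, ← totMap_apply, totOf_apply_of_mem_homog (h p)]

end

variable {B : J → EInftyAlg k} {π : ∀ p, X ⟶ (B p).X} (hπ : Function.Injective (totPi π))
  (hact : ∀ {r d : ℕ} (w : Fin (d + 1) → Arr r) (x : Fin r → Tot X),
    (fun p => (B p).act w fun t => totMap (π p) (x t)) ∈ LinearMap.range (totPi π))

/-- The operation on a complex that is the restriction of the operation of a product of
`E_∞`-algebras along an injection. -/
noncomputable def actOfInjective {r d : ℕ} (w : Fin (d + 1) → Arr r) :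
    MultilinearMap k (fun _ : Fin r => Tot X) (Tot X) :=
  (LinearEquiv.ofInjective (totPi π) hπ).symm.toLinearMap.compMultilinearMap <|
    (MultilinearMap.pi fun p =>
      ((B p).act w).compLinearMap fun _ => totMap (π p)).codRestrict _ (hact w)

lemma totMap_actOfInjective {r d : ℕ} (w : Fin (d + 1) → Arr r) (x : Fin r → Tot X) (p : J) :
    totMap (π p) (actOfInjective hπ hact w x) = (B p).act w fun t => totMap (π p) (x t) :=
  congrFun (congrArg Subtype.val ((LinearEquiv.ofInjective (totPi π) hπ).apply_symm_apply
    ⟨fun p => (B p).act w fun t => totMap (π p) (x t), hact w x⟩)) p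

/-- The structure of an `E_∞`-algebra on a complex that embeds into a product of `E_∞`-algebras
with image closed under the operations. -/
noncomputable def EInftyAlg.ofInjective : EInftyAlg k where
  X := X
  act := actOfInjective hπ hact
  act_mem w e x hx := mem_homog_of_totPi_injective hπ fun p => by
    rw [totMap_actOfInjective]
    exact (B p).act_mem w e _ fun t => totMap_mem_homog _ (hx t)
  act_degenerate w l hl := MultilinearMap.ext fun x => ext_of_totPi_injective hπ fun p => by
    simp [totMap_actOfInjective, (B p).act_degenerate w l hl]
  act_d_zero w e x hx := ext_of_totPi_injective hπ fun p => by
    simpa only [totMap_totD, totMap_actOfInjective, map_sum, map_zsmul_unit, totMap_update]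
      using (B p).act_d_zero w e _ fun t => totMap_mem_homog (π p) (hx t)
  act_d_succ w e x hx := ext_of_totPi_injective hπ fun p => by
    simpa only [totMap_totD, totMap_actOfInjective, map_add, map_sum, map_zsmul_unit,
      totMap_update] using (B p).act_d_succ w e _ fun t => totMap_mem_homog (π p) (hx t)
  act_relabel w σ e x hx := ext_of_totPi_injective hπ fun p => by
    simpa only [totMap_actOfInjective, map_zsmul_unit]
      using (B p).act_relabel w σ e _ fun t => totMap_mem_homog (π p) (hx t)
  act_one x := ext_of_totPi_injective hπ fun p => by
    rw [totMap_actOfInjective, (B p).act_one]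
  act_comp i w v e x hx := ext_of_totPi_injective hπ fun p => by
    simpa only [totMap_actOfInjective, map_sum, map_zsmul_unit, apply_dite (totMap (π p))]
      using (B p).act_comp i w v e _ fun t => totMap_mem_homog (π p) (hx t)

end Subproducts

section Generated

variable {k : Type u} [Field k]

/-- The expressions, indexed by their degrees, that are formed from generators of given degrees
with the differential and the operations of an `E_∞`-algebra. -/
inductive Monomial {I : Type u} (deg : I → ℤ) : ℤ → Type u
  | gen (j : I) : Monomial deg (deg j)
  | diff {i : ℤ} (m : Monomial deg i) : Monomial deg (i - 1)
  | act {r d : ℕ} (w : Fin (d + 1) → Arr r) {e : Fin r → ℤ} (m : ∀ t, Monomial deg (e t)) :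
      Monomial deg (d + ∑ t, e t)

/-- The value of a monomial in an `E_∞`-algebra at given values of the generators. -/
noncomputable def Monomial.eval {I : Type u} {deg : I → ℤ} (B : EInftyAlg k)
    (v : ∀ j, B.X.X (deg j)) : ∀ {i : ℤ}, Monomial deg i → B.X.X i
  | _, .gen j => v j
  | _, .diff m => (B.X.d _ _).hom (m.eval B v)
  | _, .act w m => B.act w (fun i => totOf B.X _ ((m i).eval B v)) _

lemma totOf_eval_act {I : Type u} {deg : I → ℤ} (B : EInftyAlg k) (v : ∀ j, B.X.X (deg j))
    {r d : ℕ} (w : Fin (d + 1) → Arr r) {e : Fin r → ℤ} (m : ∀ t, Monomial deg (e t)) :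
    totOf B.X _ ((Monomial.act w m).eval B v) =
      B.act w fun t => totOf B.X (e t) ((m t).eval B v) :=
  totOf_apply_of_mem_homog (B.act_mem w e _ fun _ => totOf_mem_homog _ _)

variable {I : Type u} {deg : I → ℤ} {J : Type*} (B : J → EInftyAlg k)
  (v : ∀ p j, (B p).X.X (deg j))

/-- The evaluation of linear combinations of monomials in all algebras of a family. -/
noncomputable def evalAll (i : ℤ) : (Monomial deg i →₀ k) →ₗ[k] ∀ p, (B p).X.X i :=
  Finsupp.linearCombination k fun m p => m.eval (B p) (v p)

/-- The degree `i` part of the subalgebra of `∏ p, B p` generated by the families `v · j`, as a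
quotient of the vector space on all monomials: in contrast to the product, it is small. -/
abbrev GeneratedModule (i : ℤ) : Type u :=
  (Monomial deg i →₀ k) ⧸ LinearMap.ker (evalAll B v i)

/-- The embedding of the generated subalgebra into the product. -/
noncomputable def generatedIncl (i : ℤ) : GeneratedModule B v i →ₗ[k] ∀ p, (B p).X.X i :=
  (LinearMap.ker (evalAll B v i)).liftQ (evalAll B v i) le_rfl

lemma generatedIncl_injective (i : ℤ) : Function.Injective (generatedIncl B v i) :=
  LinearMap.ker_eq_bot.1 (Submodule.ker_liftQ_eq_bot' _ _ rfl)

/-- The class of a monomial in the generated subalgebra. -/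
noncomputable def monomialClass {i : ℤ} (m : Monomial deg i) : GeneratedModule B v i :=
  Submodule.Quotient.mk (Finsupp.single m 1)

lemma generatedIncl_monomialClass {i : ℤ} (m : Monomial deg i) :
    generatedIncl B v i (monomialClass B v m) = fun p => m.eval (B p) (v p) :=
  (Finsupp.linearCombination_single k 1 m).trans (one_smul k _)

lemma span_monomialClass (i : ℤ) :
    Submodule.span k (Set.range (monomialClass B v (i := i))) = ⊤ := by
  have h := Submodule.map_span (LinearMap.ker (evalAll B v i)).mkQ
    (Set.range (Finsupp.basisSingleOne (R := k)))
  rw [Module.Basis.span_eq, Submodule.map_top, Submodule.range_mkQ, ← Set.range_comp] at h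
  refine .trans (congrArg (fun f => Submodule.span k (Set.range f)) (funext fun m => ?_)) h.symm
  rw [Function.comp_apply, Finsupp.coe_basisSingleOne]
  rfl

lemma piD_generatedIncl_mem_range (i j : ℤ) (x : GeneratedModule B v i) :
    piD (fun p => (B p).X) i j (generatedIncl B v i x) ∈ LinearMap.range (generatedIncl B v j) := by
  suffices LinearMap.range (piD (fun p => (B p).X) i j ∘ₗ generatedIncl B v i) ≤
      LinearMap.range (generatedIncl B v j) from this ⟨x, rfl⟩
  rw [← Submodule.map_top, ← span_monomialClass, Submodule.map_span_le]
  rintro _ ⟨m, rfl⟩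
  rw [LinearMap.comp_apply, generatedIncl_monomialClass]
  by_cases hij : j + 1 = i
  · obtain rfl : j = i - 1 := by omega
    exact ⟨monomialClass B v m.diff, generatedIncl_monomialClass B v _⟩
  · refine ⟨0, ?_⟩
    funext p
    simp [piD, (B p).X.shape i j hij]

/-- The complex underlying the generated subalgebra. -/
noncomputable def generatedComplex : ChainComplex (ModuleCat.{u} k) ℤ :=
  complexOfInjective (C := fun p => (B p).X) (M := GeneratedModule B v) _
    (generatedIncl_injective B v) (piD_generatedIncl_mem_range B v)

/-- The projection of `generatedComplex` to a factor of the product. -/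
noncomputable def generatedProj (p : J) : generatedComplex B v ⟶ (B p).X :=
  complexOfInjective.proj _ _ _ p

lemma totPi_generatedProj_injective : Function.Injective (totPi (generatedProj B v)) :=
  totPi_injective (generatedIncl_injective B v)

/-- The class of a monomial in the total space of the generated subalgebra. -/
noncomputable def totClass {i : ℤ} (m : Monomial deg i) : Tot (generatedComplex B v) :=
  totOf (generatedComplex B v) i (monomialClass B v m)

lemma totMap_totClass (p : J) {i : ℤ} (m : Monomial deg i) :
    totMap (generatedProj B v p) (totClass B v m) = totOf (B p).X i (m.eval (B p) (v p)) :=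
  (totMap_totOf _ _ _).trans <|
    congrArg (totOf (B p).X i) (congrFun (generatedIncl_monomialClass B v m) p)

lemma span_totClass :
    Submodule.span k (Set.range fun m : Σ i, Monomial deg i => totClass B v m.2) = ⊤ :=
  span_totOf_eq_top (X := generatedComplex B v) (span_monomialClass B v)

lemma act_totMap_generatedProj_mem_range {r d : ℕ} (w : Fin (d + 1) → Arr r)
    (x : Fin r → Tot (generatedComplex B v)) :
    (fun p => (B p).act w fun t => totMap (generatedProj B v p) (x t)) ∈
      LinearMap.range (totPi (generatedProj B v)) := by
  refine multilinearMap_apply_mem_of_span_eq_top (fun _ => span_totClass B v)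
    (MultilinearMap.pi fun p => ((B p).act w).compLinearMap fun _ => totMap (generatedProj B v p))
    (LinearMap.range (totPi (generatedProj B v)))
    (fun m => ⟨totClass B v (.act w fun t => (m t).2), funext fun p => ?_⟩) x
  refine (totMap_totClass B v p _).trans ((totOf_eval_act _ _ _ _).trans ?_)
  exact congrArg ((B p).act w) (funext fun t => (totMap_totClass B v p _).symm)

/-- The subalgebra of `∏ p, B p` that is generated by the families `v · j`. -/
noncomputable abbrev generated : EInftyAlg k :=
  EInftyAlg.ofInjective (totPi_generatedProj_injective B v)
    (act_totMap_generatedProj_mem_range B v)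

/-- The projection of `generated` to a factor of the product. -/
noncomputable def generatedHom (p : J) : generated B v ⟶ B p where
  hom := generatedProj B v p
  map_act w x := totMap_actOfInjective _ (act_totMap_generatedProj_mem_range B v) w x p

lemma totClass_diff {i : ℤ} (m : Monomial deg i) :
    totClass B v m.diff = totD (generatedComplex B v) (totClass B v m) :=
  ext_of_totPi_injective (totPi_generatedProj_injective B v) fun p => by
    rw [totMap_totD, totMap_totClass, totMap_totClass, totD_totOf]
    rfl

lemma totClass_act {r d : ℕ} (w : Fin (d + 1) → Arr r) {e : Fin r → ℤ}
    (m : ∀ t, Monomial deg (e t)) :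
    totClass B v (.act w m) = (generated B v).act w fun t => totClass B v (m t) :=
  ext_of_totPi_injective (totPi_generatedProj_injective B v) fun p => by
    refine .trans ?_ ((generatedHom B v p).map_act w _).symm
    simp only [totMap_totClass, totOf_eval_act]
    exact congrArg ((B p).act w) (funext fun t => (totMap_totClass B v p _).symm)

lemma generated_hom_ext {C : EInftyAlg k} {f g : generated B v ⟶ C}
    (h : ∀ j, totMap f.hom (totClass B v (.gen j)) = totMap g.hom (totClass B v (.gen j))) :
    f = g := by
  refine EInftyAlg.Hom.ext (totMap_injective (LinearMap.ext_on_range (span_totClass B v) ?_))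
  rintro ⟨i, m⟩
  induction m with
  | gen j => exact h j
  | diff m ih =>
    rw [totClass_diff]
    exact (totMap_totD f.hom _).trans ((congrArg (totD C.X) ih).trans (totMap_totD g.hom _).symm)
  | act w m ih =>
    rw [totClass_act]
    exact (f.map_act w _).trans ((congrArg (C.act w) (funext ih)).trans (g.map_act w _).symm)

end Generated

/-! ## The coend -/

open Simplicial

section TensorHom

variable {k : Type u} [Field k]

lemma map_atFace {Y : SSet.{u}} {M N F : Type*} [Zero M] [Zero N] [FunLike F M N]
    [ZeroHomClass F M N] (g : F) (f : ∀ n : ℕ, Y _⦋n⦌ → M) {n : ℕ} (y : Y _⦋n⦌)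
    (L : List (Fin (n + 1))) : g (atFace f y L) = atFace (fun n y => g (f n y)) y L := by
  unfold atFace
  split_ifs
  · rfl
  · exact map_zero g

lemma atFace_app {Y Y' : SSet.{u}} {M : Type*} [Zero M] (g : Y ⟶ Y') (f : ∀ n : ℕ, Y' _⦋n⦌ → M)
    {n : ℕ} (y : Y _⦋n⦌) (L : List (Fin (n + 1))) :
    atFace f (g.app _ y) L = atFace (fun n y => f n (g.app _ y)) y L := by
  unfold atFace
  split_ifs
  · exact congrArg (f _) (NatTrans.naturality_apply g _ y).symm
  · rfl

/-- The morphism to an algebra embedded in a product that is given by its components and by a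
factorization of the underlying maps. -/
noncomputable def TensorHom.ofInjective {Y : SSet.{u}} {A C : EInftyAlg k} {J : Type*}
    {B : J → EInftyAlg k} {π : ∀ p, C ⟶ B p} (hπ : Function.Injective (totPi fun p => (π p).hom))
    (φ : ∀ p, TensorHom Y A (B p)) (F : ∀ n : ℕ, Y _⦋n⦌ → (Tot A.X →ₗ[k] Tot C.X))
    (hF : ∀ p n y, totMap (π p).hom ∘ₗ F n y = (φ p).toFun n y) : TensorHom Y A C where
  toFun := F
  map_mem n y e a ha := mem_homog_of_totPi_injective hπ fun p => by
    simpa only [← hF, LinearMap.comp_apply] using (φ p).map_mem n y e a ha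
  map_degenerate n y hy := LinearMap.ext fun a => ext_of_totPi_injective hπ fun p => by
    simpa only [← hF, LinearMap.comp_apply, LinearMap.zero_apply, map_zero]
      using LinearMap.congr_fun ((φ p).map_degenerate n y hy) a
  map_d_zero y a := ext_of_totPi_injective hπ fun p => by
    simpa only [← hF, LinearMap.comp_apply, totMap_totD] using (φ p).map_d_zero y a
  map_d_succ n y e a ha := ext_of_totPi_injective hπ fun p => by
    simpa only [← hF, LinearMap.comp_apply, map_sub, map_sum, map_zsmul_unit, totMap_totD]
      using (φ p).map_d_succ n y e a ha
  map_act w n y e a ha := ext_of_totPi_injective hπ fun p => by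
    have hface (L : List (Fin (n + 1))) (b : Tot A.X) :
        atFace (φ p).toFun y L b = totMap (π p).hom (atFace F y L b) := by
      rw [show (φ p).toFun = fun n y => totMap (π p).hom ∘ₗ F n y from
        funext₂ fun n y => (hF p n y).symm]
      exact LinearMap.congr_fun (map_atFace (LinearMap.compRight k (totMap (π p).hom)) F y L).symm b
    refine .trans (LinearMap.congr_fun (hF p n y) _) (((φ p).map_act w n y e a ha).trans ?_)
    simp only [map_sum, map_list_sum, List.map_map, Function.comp_def, map_zsmul_unit, hface,
      EInftyAlg.Hom.map_act]

/-- The restriction of a morphism from the tensor product along a map of simplicial sets. -/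
noncomputable def TensorHom.precomp {Y Y' : SSet.{u}} {A B : EInftyAlg k} (g : Y ⟶ Y')
    (φ : TensorHom Y' A B) : TensorHom Y A B where
  toFun n y := φ.toFun n (g.app _ y)
  map_mem n y := φ.map_mem n _
  map_degenerate n y hy := φ.map_degenerate n _ (SSet.degenerate_app_apply hy g)
  map_d_zero y := φ.map_d_zero _
  map_d_succ n y e a ha := by
    simpa only [SSet.δ_naturality_apply] using φ.map_d_succ n (g.app _ y) e a ha
  map_act w n y e a ha := by
    simpa only [atFace_app] using φ.map_act w n (g.app _ y) e a ha

end TensorHom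

section Coend

variable {k : Type u} [Field k] {G : Type u} [Group G] {X : SSet.{u}} {P : PBun G X}
  {Q : EquivEInftyAlg G k}

/-- The generators of the coend: the simplices of `P × Δ^n × G^n`, for all `n`, paired with the
homogeneous elements of `Q`. -/
structure CoendGen (P : PBun G X) (Q : EquivEInftyAlg G k) where
  n : ℕ
  c : (BG G) _⦋n⦌
  l : ℕ
  y : (P.P ⊗ Δ[n]) _⦋l⦌
  e : ℤ
  a : Q.under.X.X e

/-- The degree of a generator of the coend. -/
abbrev CoendGen.deg (j : CoendGen P Q) : ℤ := j.e + j.l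

/-- The value of a cowedge at a generator of the coend. -/
noncomputable def Cowedge.value {B : EInftyAlg k} (v : Cowedge P Q B) (j : CoendGen P Q) :
    B.X.X j.deg :=
  (v.toHom j.n j.c).toFun j.l j.y (totOf _ j.e j.a) j.deg

lemma Cowedge.totOf_value {B : EInftyAlg k} (v : Cowedge P Q B) (j : CoendGen P Q) :
    totOf B.X j.deg (v.value j) = (v.toHom j.n j.c).toFun j.l j.y (totOf _ j.e j.a) :=
  totOf_apply_of_mem_homog ((v.toHom j.n j.c).map_mem _ _ _ _ (totOf_mem_homog _ _))

variable (P Q)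

/-- The `E_∞`-algebra underlying the coend: the subalgebra generated by the values of all cowedges
in the product of their targets. -/
noncomputable abbrev coendAlg : EInftyAlg k :=
  generated (fun p : Σ B, Cowedge P Q B => p.1) fun p => p.2.value

/-- The morphism out of the coend that is given by a cowedge. -/
noncomputable abbrev coendDesc (p : Σ B, Cowedge P Q B) : coendAlg P Q ⟶ p.1 :=
  generatedHom (fun p : Σ B, Cowedge P Q B => p.1) (fun p => p.2.value) p

/-- The element of the coend given by a generator. -/
noncomputable abbrev coendClass (j : CoendGen P Q) : Tot (coendAlg P Q).X :=
  totClass (fun p : Σ B, Cowedge P Q B => p.1) (fun p => p.2.value) (.gen j)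

lemma totPi_coendDesc_injective : Function.Injective (totPi fun p => (coendDesc P Q p).hom) :=
  totPi_generatedProj_injective _ _

variable {P Q}

lemma totMap_coendDesc_coendClass (p : Σ B, Cowedge P Q B) (j : CoendGen P Q) :
    totMap (coendDesc P Q p).hom (coendClass P Q j) =
      (p.2.toHom j.n j.c).toFun j.l j.y (totOf _ j.e j.a) :=
  (totMap_totClass _ _ p _).trans (p.2.totOf_value j)

lemma toFun_mem_range_totPi_coendDesc (n : ℕ) (c : (BG G) _⦋n⦌) (l : ℕ) (y : (P.P ⊗ Δ[n]) _⦋l⦌)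
    (a : Tot Q.under.X) :
    LinearMap.pi (fun p : Σ B, Cowedge P Q B => (p.2.toHom n c).toFun l y) a ∈
      LinearMap.range (totPi fun p => (coendDesc P Q p).hom) := by
  induction a using DirectSum.induction_on with
  | zero => rw [map_zero]; exact zero_mem _
  | of e a =>
    exact ⟨coendClass P Q ⟨n, c, l, y, e, a⟩, funext fun p => totMap_coendDesc_coendClass p _⟩
  | add a b ha hb => rw [map_add]; exact add_mem ha hb

/-- The components of the universal cowedge. -/
noncomputable def coendMap (n : ℕ) (c : (BG G) _⦋n⦌) (l : ℕ) (y : (P.P ⊗ Δ[n]) _⦋l⦌) :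
    Tot Q.under.X →ₗ[k] Tot (coendAlg P Q).X :=
  LinearMap.codRestrictOfInjective
    (LinearMap.pi fun p : Σ B, Cowedge P Q B => (p.2.toHom n c).toFun l y) _
    (totPi_coendDesc_injective P Q) (toFun_mem_range_totPi_coendDesc n c l y)

lemma totMap_coendDesc_coendMap (p : Σ B, Cowedge P Q B) (n : ℕ) (c : (BG G) _⦋n⦌) (l : ℕ)
    (y : (P.P ⊗ Δ[n]) _⦋l⦌) :
    totMap (coendDesc P Q p).hom ∘ₗ coendMap n c l y = (p.2.toHom n c).toFun l y :=
  LinearMap.ext fun a => congrFun (LinearMap.codRestrictOfInjective_comp_apply _ _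
    (totPi_coendDesc_injective P Q) (toFun_mem_range_totPi_coendDesc n c l y) a) p

lemma coendMap_totOf (j : CoendGen P Q) :
    coendMap j.n j.c j.l j.y (totOf _ j.e j.a) = coendClass P Q j :=
  ext_of_totPi_injective (totPi_coendDesc_injective P Q) fun p =>
    (LinearMap.congr_fun (totMap_coendDesc_coendMap p _ _ _ _) _).trans
      (totMap_coendDesc_coendClass p j).symm

variable (P Q)

/-- The universal cowedge. -/
noncomputable def coendCowedge : Cowedge P Q (coendAlg P Q) where
  toHom n c := .ofInjective (totPi_coendDesc_injective P Q) (fun p => p.2.toHom n c) (coendMap n c)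
    (totMap_coendDesc_coendMap · n c)
  w α c l x s := LinearMap.ext fun a => ext_of_totPi_injective (totPi_coendDesc_injective P Q)
    fun p => (LinearMap.congr_fun (totMap_coendDesc_coendMap p _ _ _ _) a).trans <|
      (LinearMap.congr_fun (p.2.w α c l x s) a).trans
        (LinearMap.congr_fun (totMap_coendDesc_coendMap p _ _ _ _) _).symm

/-- The coend `∫^n (P × Δ^n × G^n) ⊗ Q`. -/
noncomputable def coend : Chains P Q where
  obj := coendAlg P Q
  cowedge := coendCowedge P Q
  existsUnique_desc B v := by
    refine ⟨coendDesc P Q ⟨B, v⟩, fun n c l y => (totMap_coendDesc_coendMap ⟨B, v⟩ n c l y).symm,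
      fun f hf => generated_hom_ext _ _ fun j => ?_⟩
    calc totMap f.hom (coendClass P Q j)
        = totMap f.hom (coendMap j.n j.c j.l j.y (totOf _ j.e j.a)) := by rw [coendMap_totOf]
      _ = (v.toHom j.n j.c).toFun j.l j.y (totOf _ j.e j.a) :=
        (LinearMap.congr_fun (hf j.n j.c j.l j.y) _).symm
      _ = totMap (coendDesc P Q ⟨B, v⟩).hom (coendClass P Q j) :=
        (totMap_coendDesc_coendClass ⟨B, v⟩ j).symm

end Coend

/-! ## Induced maps -/

section Induced

variable {k : Type u} [Field k] {G : Type u} [Group G] {X : SSet.{u}} {P P' P'' : PBun G X}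
  {Q : EquivEInftyAlg G k}

/-- The restriction of a cowedge along a morphism of bundles. -/
noncomputable def Cowedge.precomp {B : EInftyAlg k} (f : P ⟶ P') (v : Cowedge P' Q B) :
    Cowedge P Q B where
  toHom n c := (v.toHom n c).precomp (f.hom ▷ Δ[n])
  w α c l p s :=
    (v.w α c l (f.hom.app _ p) s).trans (by rw [← f.map_ract]; rfl)

namespace Chains

lemma existsUnique_isInduced (H : Chains P Q) (H' : Chains P' Q) (f : P ⟶ P') :
    ∃! F : H.obj ⟶ H'.obj, H.IsInduced H' f F := by
  obtain ⟨F, hF, hu⟩ := H.existsUnique_desc H'.obj (H'.cowedge.precomp f)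
  exact ⟨F, fun n c l p s => (hF n c l (p, s)).symm,
    fun F' h' => hu F' fun n c l y => (h' n c l y.1 y.2).symm⟩

lemma IsInduced.id (H : Chains P Q) : H.IsInduced H (𝟙 P) (𝟙 H.obj) :=
  fun n c l p s => congrArg (· ∘ₗ (H.cowedge.toHom n c).toFun l (p, s)) (totMap_id H.obj.X)

lemma IsInduced.comp {H : Chains P Q} {H' : Chains P' Q} {H'' : Chains P'' Q} {f : P ⟶ P'}
    {g : P' ⟶ P''} {F : H.obj ⟶ H'.obj} {F' : H'.obj ⟶ H''.obj} (hF : H.IsInduced H' f F)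
    (hF' : H'.IsInduced H'' g F') : H.IsInduced H'' (f ≫ g) (F ≫ F') := fun n c l p s =>
  calc totMap (F.hom ≫ F'.hom) ∘ₗ (H.cowedge.toHom n c).toFun l (p, s)
      = totMap F'.hom ∘ₗ totMap F.hom ∘ₗ (H.cowedge.toHom n c).toFun l (p, s) := by
        rw [totMap_comp, LinearMap.comp_assoc]
    _ = totMap F'.hom ∘ₗ (H'.cowedge.toHom n c).toFun l (f.hom.app _ p, s) := by rw [hF]
    _ = (H''.cowedge.toHom n c).toFun l ((f ≫ g).hom.app _ p, s) := hF' n c l _ s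

/-- The morphism induced on coends by a morphism of bundles. -/
noncomputable def map (H : Chains P Q) (H' : Chains P' Q) (f : P ⟶ P') : H.obj ⟶ H'.obj :=
  (H.existsUnique_isInduced H' f).choose

lemma isInduced_map (H : Chains P Q) (H' : Chains P' Q) (f : P ⟶ P') :
    H.IsInduced H' f (H.map H' f) :=
  (H.existsUnique_isInduced H' f).choose_spec.1

lemma IsInduced.eq_map {H : Chains P Q} {H' : Chains P' Q} {f : P ⟶ P'} {F : H.obj ⟶ H'.obj}
    (h : H.IsInduced H' f F) : F = H.map H' f :=
  (H.existsUnique_isInduced H' f).unique h (H.isInduced_map H' f)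

lemma map_id (H : Chains P Q) : H.map H (𝟙 P) = 𝟙 H.obj :=
  (IsInduced.id H).eq_map.symm

lemma map_comp (H : Chains P Q) (H' : Chains P' Q) (H'' : Chains P'' Q) (f : P ⟶ P')
    (g : P' ⟶ P'') : H.map H'' (f ≫ g) = H.map H' f ≫ H'.map H'' g :=
  ((H.isInduced_map H' f).comp (H'.isInduced_map H'' g)).eq_map.symm

/-- The functor `∫_? A` given by a choice of coends. -/
noncomputable def functor (H : ∀ P : PBun G X, Chains P Q) : PBun G X ⥤ EInftyAlg k where
  obj P := (H P).obj
  map f := (H _).map (H _) f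
  map_id P := (H P).map_id
  map_comp f g := (H _).map_comp (H _) (H _) f g

lemma existsUnique_functor (H : ∀ P : PBun G X, Chains P Q) :
    ∃! F : PBun G X ⥤ EInftyAlg k, ∃ hF : ∀ P, F.obj P = (H P).obj,
      ∀ (P P' : PBun G X) (f : P ⟶ P'), (H P).IsInduced (H P') f
        (eqToHom (hF P).symm ≫ F.map f ≫ eqToHom (hF P')) := by
  refine ⟨functor H, ⟨fun _ => rfl, fun P P' f => ?_⟩, ?_⟩
  · change (H P).IsInduced (H P') f (𝟙 _ ≫ (H P).map (H P') f ≫ 𝟙 _)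
    simpa only [Category.id_comp, Category.comp_id] using (H P).isInduced_map (H P') f
  · rintro F ⟨hF, h⟩
    refine CategoryTheory.Functor.ext hF fun P P' f => ?_
    change F.map f = eqToHom (hF P) ≫ (H P).map (H P') f ≫ eqToHom (hF P').symm
    simp [← (h P P' f).eq_map]

/-- The isomorphism induced on coends by an isomorphism of bundles. -/
noncomputable def mapIso (H : Chains P Q) (H' : Chains P' Q) (f : P ≅ P') : H.obj ≅ H'.obj where
  hom := H.map H' f.hom
  inv := H'.map H f.inv
  hom_inv_id := by rw [← map_comp, f.hom_inv_id, map_id]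
  inv_hom_id := by rw [← map_comp, f.inv_hom_id, map_id]

/-- The action of the bundle automorphisms on the coend. -/
noncomputable def autAction (H : Chains P Q) : Aut P →* Aut H.obj where
  toFun g := H.mapIso H g
  map_one' := Iso.ext H.map_id
  map_mul' g h := Iso.ext (H.map_comp H H h.hom g.hom)

end Chains

end Induced

end EqHH

theorem proposition2p8_general {k : Type u} [Field k] {G : Type u} [Group G] (X : SSet.{u})
    (Q : EqHH.EquivEInftyAlg G k) :
    (∀ P : EqHH.PBun G X, Nonempty (EqHH.Chains P Q)) ∧
    (∀ H : ∀ P : EqHH.PBun G X, EqHH.Chains P Q,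
      ∃! F : EqHH.PBun G X ⥤ EqHH.EInftyAlg k, ∃ hF : ∀ P, F.obj P = (H P).obj,
        ∀ (P P' : EqHH.PBun G X) (f : P ⟶ P'), (H P).IsInduced (H P') f
          (eqToHom (hF P).symm ≫ F.map f ≫ eqToHom (hF P'))) ∧
    (∀ (P P' : EqHH.PBun G X) (H : EqHH.Chains P Q) (H' : EqHH.Chains P' Q) (f : P ≅ P'),
      ∃ F : H.obj ≅ H'.obj, H.IsInduced H' f.hom F.hom) ∧
    (∀ (P : EqHH.PBun G X) (H : EqHH.Chains P Q),
      ∃ ρ : Aut P →* Aut H.obj, ∀ g, H.IsInduced H g.hom (ρ g).hom) :=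
  ⟨fun P => ⟨EqHH.coend P Q⟩,
    EqHH.Chains.existsUnique_functor,
    fun _ _ H H' f => ⟨H.mapIso H' f, H.isInduced_map H' f.hom⟩,
    fun _ H => ⟨H.autAction, fun g => H.isInduced_map H g.hom⟩⟩

theorem proposition2p8 {k : Type u} [Field k] {G : Type u} [Group G] (X : SSet.{u})
    {A Q : EqHH.EquivEInftyAlg G k} (q : Q ⟶ A) (hq : EqHH.IsCofReplacement q) :
    (∀ P : EqHH.PBun G X, Nonempty (EqHH.Chains P Q)) ∧
    (∀ H : ∀ P : EqHH.PBun G X, EqHH.Chains P Q,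
      ∃! F : EqHH.PBun G X ⥤ EqHH.EInftyAlg k, ∃ hF : ∀ P, F.obj P = (H P).obj,
        ∀ (P P' : EqHH.PBun G X) (f : P ⟶ P'), (H P).IsInduced (H P') f
          (eqToHom (hF P).symm ≫ F.map f ≫ eqToHom (hF P'))) ∧
    (∀ (φ₀ φ₁ : X ⟶ EqHH.BG G) (H₀ : EqHH.HochschildChains φ₀ Q)
      (H₁ : EqHH.HochschildChains φ₁ Q) (f : EqHH.bundleOf φ₀ ≅ EqHH.bundleOf φ₁),
      ∃ F : H₀.obj ≅ H₁.obj, H₀.IsInduced H₁ f.hom F.hom) ∧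
    (∀ (φ : X ⟶ EqHH.BG G) (H : EqHH.HochschildChains φ Q),
      ∃ ρ : Aut (EqHH.bundleOf φ) →* Aut H.obj, ∀ g, H.IsInduced H g.hom (ρ g).hom) := by
  obtain ⟨hex, hfun, hiso, haut⟩ := proposition2p8_general X Q
  exact ⟨hex, hfun, fun _ _ => hiso _ _, fun _ => haut _⟩
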